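/- Let $\nu\ge 1$ and $a,c\in\mathbb{R}$. Let $\mathcal{A}$ be the quasi-local $C^*$-algebra of a spin-$\tfrac12$ system on $\mathbb{Z}^\nu$, i.e. the $C^*$-completion of the union of the local algebras $\mathcal{A}_\Lambda=B(\bigotimes_{x\in\Lambda}\mathbb{C}^2)$, $\Lambda\subset\mathbb{Z}^\nu$ finite, and let $\sigma_x^i\in\mathcal{A}$, $i=1,2,3$, be the Pauli matrices at the site $x$. Let $\omega_0=\bigotimes_{x\in\mathbb{Z}^\nu}P_x^{+,1}$ be the product state on $\mathcal{A}$ in which all spins have $\sigma^1=+1$: $\omega_0(A)=\mathrm{Tr}\big((\bigotimes_{x\in\Lambda}P)A\big)$ for $A\in\mathcal{A}_\Lambda$, where $P$ is the projector onto the eigenspace of $\sigma^1$ with eigenvalue $+1$. Let $\Pi_{\omega_0}$ be the GNS representation of $\omega_0$. For finite nonempty $\Lambda$ put $$H_\Lambda=\frac{1}{4|\Lambda|}\sum_{x,y\in\Lambda}\big[a(\sigma_x^1\sigma_y^1+\sigma_x^2\sigma_y^2)+c\,\sigma_x^3\sigma_y^3\big],\qquad \sigma_x^{i,\Lambda}(t)=e^{iH_\Lambda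 t}\sigma_x^i e^{-iH_\Lambda t},$$ $$\eta^t_{\Lambda,\omega_0}(\sigma^i)=\frac{1}{|\Lambda|}\sum_{x\in\Lambda}\Pi_{\omega_0}\big(\sigma_x^{i,\Lambda}(t)\big).$$ Let $\Lambda\nearrow\infty$ denote the limit in the sense of van Hove: for each box $\{x: 0\le x_j<b_j\}$ with positive integer sides $b_1,\dots,b_\nu$, consider its translates by $(k_1b_1,\dots,k_\nu b_\nu)$, $k\in\mathbb{Z}^\nu$; the number $n_b^-(\Lambda)$ of translates contained in $\Lambda$ tends to infinity, and $n_b^+(\Lambda)/n_b^-(\Lambda)\to 1$, where $n_b^+(\Lambda)$ is the number of translates that meet $\Lambda$. Then there are real functions $M^1,M^2,M^3$ of $t\in\mathbb{R}$ such that, for every $i\in\{1,2,3\}$ and every $t\in\mathbb{R}$, the strong limit $$\operatorname*{s-lim}_{\Lambda\nearrow\infty}\ \eta^t_{\Lambda,\omega_0}(\sigma^i)=\tfrac12 M^i(t)\,\mathbf{1}$$ exists, and $M^1(t)=2$ for all $t\ge 0$. -/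

import Mathlib

open Filter Topology
open scoped InnerProductSpace ComplexOrder

namespace QuantumSpin

/-! ### Configurations and the reference Hilbert space -/

/-- Overwrite the configuration `s` inside the finite region `L` by `u`. -/
def overwrite {G : Type*} [DecidableEq G] {L : Finset G} (s : G → Fin 2) (u : L → Fin 2) :
    G → Fin 2 :=
  fun x => if h : x ∈ L then u ⟨x, h⟩ else s x

/-- Restriction of a configuration to the finite region `L`. -/
def restrict {G : Type*} (L : Finset G) (s : G → Fin 2) : L → Fin 2 := fun x => s x

theorem restrict_overwrite {G : Type*} [DecidableEq G] {L : Finset G} (s : G → Fin 2)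
    (u : L → Fin 2) : restrict L (overwrite s u) = u := by
  funext x
  simp [restrict, overwrite, x.2]

theorem overwrite_overwrite {G : Type*} [DecidableEq G] {L : Finset G} (s : G → Fin 2)
    (u v : L → Fin 2) : overwrite (overwrite s u) v = overwrite s v := by
  funext x
  by_cases h : x ∈ L <;> simp [overwrite, h]

theorem overwrite_restrict {G : Type*} [DecidableEq G] {L : Finset G} (s : G → Fin 2) :
    overwrite s (restrict L s) = s := by
  funext x
  by_cases h : x ∈ L <;> simp [overwrite, restrict, h]

theorem overwrite_injOn {G : Type*} [DecidableEq G] {L : Finset G} (u v : L → Fin 2)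
    {s s' : G → Fin 2} (hs : restrict L s = u) (hs' : restrict L s' = u)
    (h : overwrite s v = overwrite s' v) : s = s' := by
  rw [← overwrite_restrict (L := L) s, ← overwrite_restrict (L := L) s', hs, hs',
    ← overwrite_overwrite s v u, h, overwrite_overwrite]

/-- The Hilbert space `ℓ²` over all spin configurations of the lattice `G` (the value `0` at a site
is "spin up in direction 3"). It only serves to host the local operators. -/
noncomputable abbrev ConfigSpace (G : Type*) := lp (fun _ : G → Fin 2 => ℂ) 2

open Classical in
theorem sum_matrixUnit_le {G : Type*} [DecidableEq G] {L : Finset G} (u v : L → Fin 2)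
    (f : ConfigSpace G) (F : Finset (G → Fin 2)) :
    ∑ s ∈ F, ‖if restrict L s = u then f (overwrite s v) else 0‖ ^ (2 : ENNReal).toReal
      ≤ ‖f‖ ^ (2 : ENNReal).toReal := by
  calc _ = ∑ s ∈ F with restrict L s = u, ‖f (overwrite s v)‖ ^ (2 : ENNReal).toReal := by
          rw [Finset.sum_filter]
          refine Finset.sum_congr rfl fun s _ => ?_
          split_ifs <;> simp
    _ = ∑ s ∈ (F.filter (fun s => restrict L s = u)).image (fun s => overwrite s v),
          ‖f s‖ ^ (2 : ENNReal).toReal := by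
          rw [Finset.sum_image]
          intro s hs s' hs' h
          exact overwrite_injOn u v (Finset.mem_filter.1 hs).2 (Finset.mem_filter.1 hs').2 h
    _ ≤ _ := lp.sum_rpow_le_norm_rpow (by simp) f _

/-- The operator `|u⟩⟨v| ⊗ 1` on configurations, `u` and `v` being configurations in `L`. -/
noncomputable def matrixUnit {G : Type*} [DecidableEq G] {L : Finset G} (u v : L → Fin 2) :
    ConfigSpace G →L[ℂ] ConfigSpace G :=
  LinearMap.mkContinuous
    { toFun := fun f => ⟨fun s => if restrict L s = u then f (overwrite s v) else 0,
        memℓp_gen' (sum_matrixUnit_le u v f)⟩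
      map_add' := fun f g => by
        ext s
        change (if restrict L s = u then (f + g : ConfigSpace G) (overwrite s v) else 0) =
          (if restrict L s = u then f (overwrite s v) else 0) +
          (if restrict L s = u then g (overwrite s v) else 0)
        by_cases h : restrict L s = u <;> simp [h]
      map_smul' := fun c f => by
        ext s
        change (if restrict L s = u then (c • f : ConfigSpace G) (overwrite s v) else 0) =
          c • (if restrict L s = u then f (overwrite s v) else 0)
        by_cases h : restrict L s = u <;> simp [h] } 1
    (fun f => by
      rw [one_mul]
      exact lp.norm_le_of_forall_sum_le (by simp) (norm_nonneg f) (sum_matrixUnit_le u v f))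

theorem matrixUnit_apply {G : Type*} [DecidableEq G] {L : Finset G} (u v : L → Fin 2)
    (f : ConfigSpace G) (s : G → Fin 2) :
    matrixUnit u v f s = if restrict L s = u then f (overwrite s v) else 0 := rfl

theorem matrixUnit_adjoint {G : Type*} [DecidableEq G] {L : Finset G} (u v : L → Fin 2) :
    star (matrixUnit (G := G) u v) = matrixUnit v u := by
  symm
  rw [ContinuousLinearMap.star_eq_adjoint, ContinuousLinearMap.eq_adjoint_iff]
  intro f g
  rw [lp.inner_eq_tsum, lp.inner_eq_tsum]
  let e : {s : G → Fin 2 | restrict L s = v} ≃ {s : G → Fin 2 | restrict L s = u} :=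
    { toFun := fun s => ⟨overwrite s.1 u, restrict_overwrite _ _⟩
      invFun := fun s => ⟨overwrite s.1 v, restrict_overwrite _ _⟩
      left_inv := fun s => Subtype.ext (by
        change overwrite (overwrite s.1 u) v = s.1
        obtain ⟨s, rfl⟩ := s
        rw [overwrite_overwrite]
        exact overwrite_restrict _)
      right_inv := fun s => Subtype.ext (by
        change overwrite (overwrite s.1 v) u = s.1
        obtain ⟨s, rfl⟩ := s
        rw [overwrite_overwrite]
        exact overwrite_restrict _) }
  have h1 : (∑' s, ⟪matrixUnit v u f s, g s⟫_ℂ) =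
      ∑' s : {s : G → Fin 2 | restrict L s = v}, ⟪f (overwrite s.1 u), g s.1⟫_ℂ := by
    rw [tsum_subtype {s : G → Fin 2 | restrict L s = v}
      (fun s => ⟪f (overwrite s u), g s⟫_ℂ)]
    refine tsum_congr fun s => ?_
    by_cases h : restrict L s = v <;> simp [matrixUnit_apply, h]
  have h2 : (∑' s, ⟪f s, matrixUnit u v g s⟫_ℂ) =
      ∑' s : {s : G → Fin 2 | restrict L s = u}, ⟪f s.1, g (overwrite s.1 v)⟫_ℂ := by
    rw [tsum_subtype {s : G → Fin 2 | restrict L s = u}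
      (fun s => ⟪f s, g (overwrite s v)⟫_ℂ)]
    refine tsum_congr fun s => ?_
    by_cases h : restrict L s = u <;> simp [matrixUnit_apply, h]
  rw [h1, h2, ← e.tsum_eq]
  refine tsum_congr fun s => ?_
  have hs : overwrite (e s).1 v = s.1 := congrArg Subtype.val (e.left_inv s)
  rw [hs]
  rfl

/-! ### Local algebras and the quasi-local algebra -/

/-- The algebra `B(⨂_{x ∈ L} ℂ²)` of the finite region `L`, in the product basis. -/
abbrev LocalMatrix {G : Type*} (L : Finset G) := Matrix (L → Fin 2) (L → Fin 2) ℂ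

/-- The operator `M ⊗ 1` on configurations. -/
noncomputable def localOp {G : Type*} [DecidableEq G] (L : Finset G) (M : LocalMatrix L) :
    ConfigSpace G →L[ℂ] ConfigSpace G :=
  ∑ u, ∑ v, M u v • matrixUnit u v

theorem localOp_apply {G : Type*} [DecidableEq G] (L : Finset G) (M : LocalMatrix L)
    (f : ConfigSpace G) (s : G → Fin 2) :
    localOp L M f s = ∑ v, M (restrict L s) v * f (overwrite s v) := by
  simp only [localOp, sum_apply, lp.coeFn_sum, Finset.sum_apply,
    smul_apply, lp.coeFn_smul, Pi.smul_apply, smul_eq_mul, matrixUnit_apply]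
  rw [Finset.sum_comm]
  refine Finset.sum_congr rfl fun v _ => ?_
  simp

/-- The embedding `M ↦ M ⊗ 1` of a local algebra, as a unital `*`-homomorphism. -/
noncomputable def localHom {G : Type*} [DecidableEq G] (L : Finset G) :
    LocalMatrix L →⋆ₐ[ℂ] (ConfigSpace G →L[ℂ] ConfigSpace G) :=
  StarAlgHom.mk (AlgHom.ofLinearMap
    { toFun := localOp L
      map_add' := fun M N => by
        simp [localOp, add_smul, Finset.sum_add_distrib]
      map_smul' := fun c M => by
        simp [localOp, mul_smul, Finset.smul_sum] }
    (by
      ext f s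
      change localOp L 1 f s = f s
      simp [localOp_apply, Matrix.one_apply, overwrite_restrict])
    (fun M N => by
      ext f s
      change localOp L (M * N) f s = localOp L M (localOp L N f) s
      simp only [localOp_apply, restrict_overwrite, overwrite_overwrite, Matrix.mul_apply,
        Finset.sum_mul, Finset.mul_sum, mul_assoc]
      rw [Finset.sum_comm]))
    (fun M => by
      change localOp L (star M) = star (localOp L M)
      simp only [localOp, star_sum, star_smul, matrixUnit_adjoint, Matrix.star_apply]
      rw [Finset.sum_comm])

theorem localHom_apply {G : Type*} [DecidableEq G] (L : Finset G) (M : LocalMatrix L)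
    (f : ConfigSpace G) (s : G → Fin 2) :
    localHom L M f s = ∑ v, M (restrict L s) v * f (overwrite s v) :=
  localOp_apply L M f s

open Classical in
/-- The embedding of a local algebra is faithful (hence isometric for the C*-norms). -/
theorem localHom_injective {G : Type*} [DecidableEq G] (L : Finset G) :
    Function.Injective (localHom (G := G) L) := by
  intro M N h
  ext u v
  have key : ∀ P : LocalMatrix L, localHom L P
      (lp.single 2 (overwrite (fun _ : G => (0 : Fin 2)) v) (1 : ℂ))
      (overwrite (fun _ => 0) u) = P u v := by
    intro P
    rw [localHom_apply, Finset.sum_eq_single v]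
    · simp [restrict_overwrite, overwrite_overwrite]
    · intro w _ hw
      rw [overwrite_overwrite, lp.single_apply, Pi.single_apply, if_neg, mul_zero]
      intro hc
      apply hw
      rw [← restrict_overwrite (fun _ : G => (0 : Fin 2)) w, hc, restrict_overwrite]
    · simp
  rw [← key M, ← key N, h]

/-- The local observables and their norm closure, as a `*`-subalgebra of operators. -/
noncomputable def quasiLocalSubalgebra (G : Type*) [DecidableEq G] :
    StarSubalgebra ℂ (ConfigSpace G →L[ℂ] ConfigSpace G) :=
  (⨆ L : Finset G, (localHom (G := G) L).range).topologicalClosure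

/-- The quasi-local C*-algebra of the spin-1/2 system on the lattice `G`: the C*-completion of the
union of the local algebras `B(⨂_{x ∈ L} ℂ²)`, `L` finite. -/
def QuasiLocal (G : Type*) [DecidableEq G] : Type _ := quasiLocalSubalgebra G

theorem isClosed_quasiLocalSubalgebra (G : Type*) [DecidableEq G] :
    IsClosed (quasiLocalSubalgebra G : Set (ConfigSpace G →L[ℂ] ConfigSpace G)) :=
  StarSubalgebra.isClosed_topologicalClosure _

/-- The C*-algebra structure inherited from the bounded operators. -/
noncomputable def QuasiLocal.cstarAlgebra (G : Type*) [DecidableEq G] :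
    CStarAlgebra (QuasiLocal G) :=
  StarSubalgebra.cstarAlgebra (quasiLocalSubalgebra G)
    (h_closed := isClosed_quasiLocalSubalgebra G)

noncomputable instance instCStarAlgebraQuasiLocal (G : Type*) [DecidableEq G] :
    CStarAlgebra (QuasiLocal G) :=
  QuasiLocal.cstarAlgebra G

noncomputable instance instPartialOrderQuasiLocal (G : Type*) [DecidableEq G] :
    PartialOrder (QuasiLocal G) :=
  CStarAlgebra.spectralOrder _

instance instStarOrderedRingQuasiLocal (G : Type*) [DecidableEq G] :
    StarOrderedRing (QuasiLocal G) :=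
  CStarAlgebra.spectralOrderedRing _

/-- The inclusion of the quasi-local algebra into the bounded operators. -/
noncomputable def QuasiLocal.toOp (G : Type*) [DecidableEq G] :
    QuasiLocal G →⋆ₐ[ℂ] (ConfigSpace G →L[ℂ] ConfigSpace G) :=
  (quasiLocalSubalgebra G).subtype

theorem localHom_mem {G : Type*} [DecidableEq G] (L : Finset G) (M : LocalMatrix L) :
    localHom L M ∈ quasiLocalSubalgebra G :=
  StarSubalgebra.le_topologicalClosure _
    ((le_iSup (fun L : Finset G => (localHom (G := G) L).range) L) ⟨M, rfl⟩)

/-- The inclusion of the local algebra of `L` into the quasi-local algebra. -/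
noncomputable def localObs {G : Type*} [DecidableEq G] (L : Finset G) :
    LocalMatrix L →⋆ₐ[ℂ] QuasiLocal G :=
  (localHom L).codRestrict (quasiLocalSubalgebra G) (localHom_mem L)

theorem toOp_localObs {G : Type*} [DecidableEq G] (L : Finset G) (M : LocalMatrix L) :
    QuasiLocal.toOp G (localObs L M) = localHom L M := rfl

/-- The simple tensor `⨂_{x ∈ L} B` of copies of one-site operators. -/
def siteTensor {G : Type*} (L : Finset G) (B : Matrix (Fin 2) (Fin 2) ℂ) : LocalMatrix L :=
  fun u v => ∏ x, B (u x) (v x)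

/-- The Pauli matrices `σ¹, σ², σ³`, indexed by `0, 1, 2`. -/
noncomputable def pauli : Fin 3 → Matrix (Fin 2) (Fin 2) ℂ :=
  ![!![0, 1; 1, 0], !![0, -Complex.I; Complex.I, 0], !![1, 0; 0, -1]]

/-- The Pauli matrix `σ_x^i` at the site `x`, an element of the quasi-local algebra. -/
noncomputable def pauliAt {G : Type*} [DecidableEq G] (x : G) (i : Fin 3) : QuasiLocal G :=
  localObs {x} (siteTensor {x} (pauli i))

/-! ### The product state -/

/-- The projector onto the eigenspace of `σ¹` with eigenvalue `+1`. -/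
noncomputable def plusProj : Matrix (Fin 2) (Fin 2) ℂ := !![1/2, 1/2; 1/2, 1/2]

theorem plusProj_eq : plusProj = (1 / 2 : ℂ) • (1 + pauli 0) := by
  ext i j
  fin_cases i <;> fin_cases j <;> simp [plusProj, pauli]

theorem siteTensor_plusProj {G : Type*} (L : Finset G) (u v : L → Fin 2) :
    siteTensor L plusProj u v = (1 / 2) ^ L.card := by
  have : ∀ i j, plusProj i j = 1 / 2 := by
    intro i j
    fin_cases i <;> fin_cases j <;> simp [plusProj]
  simp [siteTensor, this]

/-- A configuration vanishes outside `R`. -/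
def SupportedIn {G : Type*} (R : Finset G) (s : G → Fin 2) : Prop := ∀ x, x ∉ R → s x = 0

open Classical in
/-- The configurations that vanish outside `R`, as a finset. -/
noncomputable def supported {G : Type*} [DecidableEq G] (R : Finset G) : Finset (G → Fin 2) :=
  Finset.univ.image (fun u : R → Fin 2 => overwrite (fun _ => 0) u)

open Classical in
theorem mem_supported {G : Type*} [DecidableEq G] (R : Finset G) (s : G → Fin 2) :
    s ∈ supported R ↔ SupportedIn R s := by
  constructor
  · intro h
    obtain ⟨u, -, rfl⟩ := Finset.mem_image.1 h
    intro x hx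
    simp [overwrite, hx]
  · intro h
    refine Finset.mem_image.2 ⟨restrict R s, Finset.mem_univ _, ?_⟩
    funext x
    by_cases hx : x ∈ R
    · simp [overwrite, restrict, hx]
    · simp [overwrite, hx, h x hx]

open Classical in
theorem card_supported {G : Type*} [DecidableEq G] (R : Finset G) :
    (supported R).card = 2 ^ R.card := by
  rw [supported, Finset.card_image_of_injective]
  · simp
  · intro u v h
    rw [← restrict_overwrite (fun _ : G => (0 : Fin 2)) u,
      ← restrict_overwrite (fun _ : G => (0 : Fin 2)) v]
    exact congrArg _ h

theorem overwrite_mem_supported {G : Type*} [DecidableEq G] {L R : Finset G} (h : L ⊆ R)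
    (s : G → Fin 2) (u : L → Fin 2) : overwrite s u ∈ supported R ↔ s ∈ supported R := by
  rw [mem_supported, mem_supported]
  refine forall_congr' fun x => forall_congr' fun hx => ?_
  have hL : x ∉ L := fun hL => hx (h hL)
  simp [overwrite, hL]

theorem sum_supported {G : Type*} [DecidableEq G] {L R : Finset G} (h : L ⊆ R)
    (r : (L → Fin 2) → ℂ) :
    (2 : ℂ) ^ L.card * ∑ s ∈ supported R, r (restrict L s) = 2 ^ R.card * ∑ u, r u := by
  have hw : ∀ w : L → Fin 2, ∑ s ∈ supported R, r (restrict L s) =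
      ∑ s ∈ supported R, r (restrict L s + w) := by
    intro w
    have hinv : ∀ a b : Fin 2, a + b + b = a := by decide
    refine Finset.sum_nbij' (fun s => overwrite s (restrict L s + w))
      (fun s => overwrite s (restrict L s + w)) ?_ ?_ ?_ ?_ ?_
    · intro s hs; exact (overwrite_mem_supported h _ _).2 hs
    · intro s hs; exact (overwrite_mem_supported h _ _).2 hs
    · intro s _
      have : restrict L s + w + w = restrict L s := by
        funext x; exact hinv _ _
      simp only [restrict_overwrite, overwrite_overwrite, this, overwrite_restrict]
    · intro s _
      have : restrict L s + w + w = restrict L s := by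
        funext x; exact hinv _ _
      simp only [restrict_overwrite, overwrite_overwrite, this, overwrite_restrict]
    · intro s _
      have : restrict L s + w + w = restrict L s := by
        funext x; exact hinv _ _
      simp only [restrict_overwrite, this]
  calc (2 : ℂ) ^ L.card * ∑ s ∈ supported R, r (restrict L s)
      = ∑ w : L → Fin 2, ∑ s ∈ supported R, r (restrict L s + w) := by
        rw [Finset.sum_congr rfl fun w _ => (hw w).symm]
        simp
    _ = ∑ s ∈ supported R, ∑ u, r u := by
        rw [Finset.sum_comm]
        refine Finset.sum_congr rfl fun s _ => ?_
        exact Fintype.sum_equiv (Equiv.addLeft (restrict L s)) _ _ (fun _ => rfl)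
    _ = _ := by simp [card_supported]

open Classical in
/-- The (unnormalised) vector with all spins in `R` in the state `σ¹ = +1`. -/
noncomputable def plusVector {G : Type*} [DecidableEq G] (R : Finset G) : ConfigSpace G :=
  ∑ s ∈ supported R, lp.single 2 s (1 : ℂ)

open Classical in
theorem plusVector_apply {G : Type*} [DecidableEq G] (R : Finset G) (s : G → Fin 2) :
    plusVector R s = if s ∈ supported R then 1 else 0 := by
  simp only [plusVector, lp.coeFn_sum, Finset.sum_apply, lp.single_apply, Pi.single_apply]
  simp

open Classical in
theorem inner_plusVector {G : Type*} [DecidableEq G] (R : Finset G) (f : ConfigSpace G) :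
    ⟪plusVector R, f⟫_ℂ = ∑ s ∈ supported R, f s := by
  simp only [plusVector, sum_inner, lp.inner_single_left]
  simp

theorem inner_localHom_plusVector {G : Type*} [DecidableEq G] {L R : Finset G} (h : L ⊆ R)
    (M : LocalMatrix L) :
    (1 / 2 : ℂ) ^ R.card * ⟪plusVector R, localHom L M (plusVector R)⟫_ℂ =
      Matrix.trace (siteTensor L plusProj * M) := by
  have h1 : ⟪plusVector R, localHom L M (plusVector R)⟫_ℂ =
      ∑ s ∈ supported R, ∑ v, M (restrict L s) v := by
    rw [inner_plusVector]
    refine Finset.sum_congr rfl fun s hs => ?_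
    rw [localHom_apply]
    refine Finset.sum_congr rfl fun v _ => ?_
    rw [plusVector_apply, if_pos ((overwrite_mem_supported h s v).2 hs), mul_one]
  have h2 := sum_supported h (fun u => ∑ v, M u v)
  have h3 : Matrix.trace (siteTensor L plusProj * M) = (1 / 2) ^ L.card * ∑ u, ∑ v, M u v := by
    simp only [Matrix.trace, Matrix.diag, Matrix.mul_apply, siteTensor_plusProj, Finset.mul_sum]
    rw [Finset.sum_comm]
  rw [h1, h3, one_div, inv_pow, inv_pow, inv_mul_eq_iff_eq_mul₀ (by positivity),
    ← mul_right_inj' (show (2 : ℂ) ^ L.card ≠ 0 by positivity), h2]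
  field_simp

/-- There is a positive functional on the quasi-local algebra whose restriction to each local
algebra is given by the density matrix `⨂_{x ∈ L} P`, `P` the projector onto `σ¹ = +1`. -/
theorem exists_productState (G : Type*) [DecidableEq G] :
    ∃ ω : QuasiLocal G →ₚ[ℂ] ℂ, ∀ (L : Finset G) (M : LocalMatrix L),
      ω (localObs L M) = Matrix.trace (siteTensor L plusProj * M) := by
  let g : Finset G → QuasiLocal G → ℂ := fun R A =>
    (1 / 2 : ℂ) ^ R.card * ⟪plusVector R, QuasiLocal.toOp G A (plusVector R)⟫_ℂ
  have hnorm : ∀ R : Finset G, (1 / 2 : ℝ) ^ R.card * (‖plusVector R‖ * ‖plusVector R‖) = 1 := by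
    intro R
    have h := inner_plusVector R (plusVector R)
    have h' : ∑ s ∈ supported R, (plusVector R) s = (2 : ℂ) ^ R.card := by
      rw [Finset.sum_congr rfl fun s hs => by rw [plusVector_apply, if_pos hs]]
      simp [card_supported]
    rw [h', inner_self_eq_norm_sq_to_K] at h
    have h'' : ‖plusVector R‖ ^ 2 = (2 : ℝ) ^ R.card := by
      apply Complex.ofReal_injective
      push_cast
      exact h
    rw [← sq, h'', ← mul_pow]
    norm_num
  have hbd : ∀ A R, g R A ∈ Metric.closedBall (0 : ℂ) ‖QuasiLocal.toOp G A‖ := by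
    intro A R
    rw [mem_closedBall_zero_iff, norm_mul, norm_pow]
    have h1 := norm_inner_le_norm (𝕜 := ℂ) (plusVector R) (QuasiLocal.toOp G A (plusVector R))
    have h2 := (QuasiLocal.toOp G A).le_opNorm (plusVector R)
    calc ‖(1 / 2 : ℂ)‖ ^ R.card * ‖⟪plusVector R, QuasiLocal.toOp G A (plusVector R)⟫_ℂ‖
        ≤ (1 / 2 : ℝ) ^ R.card *
          (‖plusVector R‖ * (‖QuasiLocal.toOp G A‖ * ‖plusVector R‖)) := by
          have : ‖(1 / 2 : ℂ)‖ = 1 / 2 := by norm_num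
          rw [this]
          gcongr
          exact h1.trans (by gcongr)
      _ = ‖QuasiLocal.toOp G A‖ * ((1 / 2 : ℝ) ^ R.card * (‖plusVector R‖ * ‖plusVector R‖)) := by
          ring
      _ = ‖QuasiLocal.toOp G A‖ := by rw [hnorm, mul_one]
  let U : Ultrafilter (Finset G) := Ultrafilter.of atTop
  have hlim : ∀ A, ∃ z, Tendsto (fun R => g R A) U (𝓝 z) := by
    intro A
    obtain ⟨z, -, hz⟩ := (isCompact_closedBall (0 : ℂ) ‖QuasiLocal.toOp G A‖).ultrafilter_le_nhds
      (U.map fun R => g R A) (by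
        rw [Ultrafilter.coe_map, le_principal_iff, mem_map]
        exact univ_mem' (hbd A))
    exact ⟨z, hz⟩
  choose ℓ hℓ using hlim
  let φ : QuasiLocal G →ₗ[ℂ] ℂ :=
    { toFun := ℓ
      map_add' := fun A B => by
        refine tendsto_nhds_unique (hℓ (A + B)) (((hℓ A).add (hℓ B)).congr fun R => ?_)
        simp only [g, map_add, add_apply, inner_add_right, mul_add]
      map_smul' := fun c A => by
        refine tendsto_nhds_unique (hℓ (c • A)) (((hℓ A).const_mul c).congr fun R => ?_)
        simp only [g, map_smul, smul_apply, inner_smul_right]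
        ring }
  refine ⟨PositiveLinearMap.mk₀ φ ?_, ?_⟩
  · intro A hA
    obtain ⟨B, rfl⟩ := CStarAlgebra.nonneg_iff_eq_star_mul_self.1 hA
    refine ge_of_tendsto' (hℓ (star B * B)) fun R => ?_
    simp only [g, map_mul, map_star, mul_apply_eq_comp,
      ContinuousLinearMap.star_eq_adjoint, ContinuousLinearMap.adjoint_inner_right]
    rw [inner_self_eq_norm_sq_to_K]
    have h1 : (1 / 2 : ℂ) = ((1 / 2 : ℝ) : ℂ) := by norm_num
    have h2 : (0 : ℝ) ≤ (1 / 2) ^ R.card * ‖QuasiLocal.toOp G B (plusVector R)‖ ^ 2 := by positivity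
    have h3 := Complex.zero_le_real.2 h2
    push_cast at h3
    rw [h1]
    push_cast
    exact h3
  · intro L M
    refine tendsto_nhds_unique (hℓ (localObs L M)) (tendsto_const_nhds.congr' ?_)
    have hev : ∀ᶠ R in (U : Filter (Finset G)), L ⊆ R :=
      (Ultrafilter.of_le (atTop : Filter (Finset G))) (eventually_ge_atTop L)
    filter_upwards [hev] with R hR
    exact (inner_localHom_plusVector hR M).symm

/-- The product state `ω₀ = ⨂_x P_x^{+,1}` on the quasi-local algebra, in which all spins have
`σ¹ = +1`. It is determined by its values on the local algebras, see `productState_localObs`. -/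
noncomputable def productState (G : Type*) [DecidableEq G] : QuasiLocal G →ₚ[ℂ] ℂ :=
  Classical.choose (exists_productState G)

theorem productState_localObs {G : Type*} [DecidableEq G] (L : Finset G) (M : LocalMatrix L) :
    productState G (localObs L M) = Matrix.trace (siteTensor L plusProj * M) :=
  Classical.choose_spec (exists_productState G) L M

/-! ### The mean-field dynamics and the space averages -/

/-- The mean-field Hamiltonian
`H_L = (1 / 4|L|) ∑_{x,y ∈ L} [a (σ_x¹ σ_y¹ + σ_x² σ_y²) + c σ_x³ σ_y³]`. -/
noncomputable def hamiltonian {G : Type*} [DecidableEq G] (a c : ℝ) (L : Finset G) :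
    QuasiLocal G :=
  (1 / (4 * (L.card : ℂ))) • ∑ x ∈ L, ∑ y ∈ L,
    ((a : ℂ) • (pauliAt x 0 * pauliAt y 0 + pauliAt x 1 * pauliAt y 1)
      + (c : ℂ) • (pauliAt x 2 * pauliAt y 2))

/-- The evolved spin `σ_x^{i,L}(t) = exp(i H_L t) σ_x^i exp(-i H_L t)`. -/
noncomputable def evolvedPauli {G : Type*} [DecidableEq G] (a c : ℝ) (L : Finset G) (t : ℝ)
    (x : G) (i : Fin 3) : QuasiLocal G :=
  NormedSpace.exp ((Complex.I * t) • hamiltonian a c L) * pauliAt x i *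
    NormedSpace.exp ((-(Complex.I * t)) • hamiltonian a c L)

/-- The space average `η_L^t(σ^i) = |L|⁻¹ ∑_{x ∈ L} Π(σ_x^{i,L}(t))`, an operator on the GNS Hilbert
space of the product state. -/
noncomputable def spaceAverage {G : Type*} [DecidableEq G] (a c : ℝ) (L : Finset G) (t : ℝ)
    (i : Fin 3) : (productState G).GNS →L[ℂ] (productState G).GNS :=
  (1 / (L.card : ℂ)) • ∑ x ∈ L, (productState G).gnsStarAlgHom (evolvedPauli a c L t x i)

/-! ### The infinite-volume limit in the sense of van Hove -/

/-- The box `{x : 0 ≤ x_i < a_i}` translated by the multiple `(k_1 a_1, …, k_ν a_ν)`. -/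
def cell {ν : ℕ} (a : Fin ν → ℕ) (k : Fin ν → ℤ) : Set (Fin ν → ℤ) :=
  {x | ∀ i, k i * a i ≤ x i ∧ x i < (k i + 1) * a i}

/-- The number of cells contained in `L`. -/
noncomputable def innerCells {ν : ℕ} (a : Fin ν → ℕ) (L : Finset (Fin ν → ℤ)) : ℕ :=
  {k : Fin ν → ℤ | cell a k ⊆ L}.ncard

/-- The number of cells that meet `L`. -/
noncomputable def outerCells {ν : ℕ} (a : Fin ν → ℕ) (L : Finset (Fin ν → ℤ)) : ℕ :=
  {k : Fin ν → ℤ | (cell a k ∩ L).Nonempty}.ncard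

/-- The filter of finite regions tending to infinity in the sense of van Hove: for each box with
positive side lengths `a`, the number of its cells in `L` tends to infinity, and the ratio of the
number of cells that meet `L` to the number of cells in `L` tends to `1`. -/
noncomputable def vanHove (ν : ℕ) : Filter (Finset (Fin ν → ℤ)) :=
  ⨅ (a : Fin ν → ℕ) (_ : ∀ i, 0 < a i),
    comap (innerCells a) atTop ⊓
      comap (fun L => (outerCells a L : ℝ) / (innerCells a L : ℝ)) (𝓝 1)

theorem cell_dvd {ν : ℕ} {a : Fin ν → ℕ} (ha : ∀ i, 0 < a i) {m : ℕ} (hm : ∀ i, a i ∣ m)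
    (k : Fin ν → ℤ) :
    (cell a k ⊆ Fintype.piFinset (fun _ : Fin ν => Finset.Ico (0 : ℤ) m) ↔
      k ∈ Fintype.piFinset (fun i => Finset.Ico (0 : ℤ) (m / a i : ℕ))) ∧
    ((cell a k ∩ Fintype.piFinset (fun _ : Fin ν => Finset.Ico (0 : ℤ) m)).Nonempty ↔
      k ∈ Fintype.piFinset (fun i => Finset.Ico (0 : ℤ) (m / a i : ℕ))) := by
  have hne : (fun i => k i * (a i : ℤ)) ∈ cell a k := by
    intro i
    have := ha i
    refine ⟨le_rfl, ?_⟩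
    have : (0 : ℤ) < a i := by exact_mod_cast this
    linarith
  have key : (cell a k ∩ Fintype.piFinset (fun _ : Fin ν => Finset.Ico (0 : ℤ) m)).Nonempty →
      k ∈ Fintype.piFinset (fun i => Finset.Ico (0 : ℤ) (m / a i : ℕ)) := by
    rintro ⟨x, hx, hx'⟩
    rw [Finset.mem_coe, Fintype.mem_piFinset] at hx'
    rw [Fintype.mem_piFinset]
    intro i
    obtain ⟨q, hq⟩ := hm i
    have h1 := hx i
    have h2 := Finset.mem_Ico.1 (hx' i)
    have h3 : (0 : ℤ) < a i := by exact_mod_cast ha i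
    have h4 : m / a i = q := by rw [hq]; exact Nat.mul_div_cancel_left q (ha i)
    rw [h4, Finset.mem_Ico]
    have h5 : (m : ℤ) = a i * q := by exact_mod_cast hq
    rw [h5] at h2
    constructor
    · by_contra hk
      nlinarith [show k i + 1 ≤ 0 by omega]
    · by_contra hk
      nlinarith [show (q : ℤ) ≤ k i by omega]
  have key' : k ∈ Fintype.piFinset (fun i => Finset.Ico (0 : ℤ) (m / a i : ℕ)) →
      cell a k ⊆ Fintype.piFinset (fun _ : Fin ν => Finset.Ico (0 : ℤ) m) := by
    intro hk x hx
    rw [Finset.mem_coe, Fintype.mem_piFinset]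
    rw [Fintype.mem_piFinset] at hk
    intro i
    obtain ⟨q, hq⟩ := hm i
    have h1 := hx i
    have h2 := Finset.mem_Ico.1 (hk i)
    have h3 : (0 : ℤ) < a i := by exact_mod_cast ha i
    have h4 : m / a i = q := by rw [hq]; exact Nat.mul_div_cancel_left q (ha i)
    rw [h4] at h2
    have h5 : (m : ℤ) = a i * q := by exact_mod_cast hq
    rw [Finset.mem_Ico, h5]
    constructor
    · nlinarith
    · nlinarith [show k i + 1 ≤ (q : ℤ) by omega]
  exact ⟨⟨fun h => key ⟨_, hne, h hne⟩, key'⟩, ⟨key, fun h => ⟨_, hne, key' h hne⟩⟩⟩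

/-- The van Hove limit is not vacuous: cubes of side `N!` tend to infinity in this sense. -/
theorem vanHove_neBot {ν : ℕ} (hν : 1 ≤ ν) : (vanHove ν).NeBot := by
  have ht : Tendsto (fun N : ℕ => Fintype.piFinset
      (fun _ : Fin ν => Finset.Ico (0 : ℤ) (N.factorial : ℕ))) atTop (vanHove ν) := by
    refine tendsto_iInf.2 fun a => tendsto_iInf.2 fun ha => ?_
    have hset : ∀ᶠ N : ℕ in atTop, ∀ i, a i ∣ N.factorial := by
      refine eventually_all.2 fun i => ?_
      filter_upwards [eventually_ge_atTop (a i)] with N hN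
      exact Nat.dvd_factorial (ha i) hN
    have hin : ∀ N : ℕ, (∀ i, a i ∣ N.factorial) → innerCells a (Fintype.piFinset
        (fun _ : Fin ν => Finset.Ico (0 : ℤ) (N.factorial : ℕ))) =
        ∏ i, N.factorial / a i := by
      intro N hN
      have hs : {k : Fin ν → ℤ | cell a k ⊆ Fintype.piFinset
          (fun _ : Fin ν => Finset.Ico (0 : ℤ) (N.factorial : ℕ))} =
          ((Fintype.piFinset (fun i => Finset.Ico (0 : ℤ) (N.factorial / a i : ℕ)) :
            Finset (Fin ν → ℤ)) : Set (Fin ν → ℤ)) := by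
        ext k
        exact (cell_dvd ha hN k).1
      rw [innerCells, hs, Set.ncard_coe_finset, Fintype.card_piFinset]
      refine Finset.prod_congr rfl fun i _ => ?_
      rw [Int.card_Ico, sub_zero]
      exact Int.toNat_natCast _
    have hout : ∀ N : ℕ, (∀ i, a i ∣ N.factorial) → outerCells a (Fintype.piFinset
        (fun _ : Fin ν => Finset.Ico (0 : ℤ) (N.factorial : ℕ))) =
        innerCells a (Fintype.piFinset
        (fun _ : Fin ν => Finset.Ico (0 : ℤ) (N.factorial : ℕ))) := by
      intro N hN
      rw [innerCells, outerCells]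
      congr 1
      ext k
      exact (cell_dvd ha hN k).2.trans (cell_dvd ha hN k).1.symm
    have hpos : ∀ N : ℕ, (∀ i, a i ∣ N.factorial) → ∀ i, 0 < N.factorial / a i := fun N hN i =>
      Nat.div_pos (Nat.le_of_dvd (Nat.factorial_pos N) (hN i)) (ha i)
    rw [tendsto_inf, tendsto_comap_iff, tendsto_comap_iff]
    constructor
    · refine tendsto_atTop.2 fun b => ?_
      filter_upwards [hset, eventually_ge_atTop (b * a ⟨0, hν⟩)] with N hN hb
      simp only [Function.comp]
      rw [hin N hN]
      calc b ≤ N.factorial / a ⟨0, hν⟩ :=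
            (Nat.le_div_iff_mul_le (ha _)).2 (hb.trans (Nat.self_le_factorial N))
        _ ≤ _ := Finset.single_le_prod' (f := fun i => N.factorial / a i)
            (fun i _ => hpos N hN i) (Finset.mem_univ _)
    · refine tendsto_const_nhds.congr' ?_
      filter_upwards [hset] with N hN
      simp only [Function.comp]
      rw [hout N hN, div_self]
      rw [hin N hN]
      exact_mod_cast (Finset.prod_pos fun i _ => hpos N hN i).ne'
  exact ht.neBot

end QuantumSpin

namespace QuantumSpin

/-! The double sum makes the Hamiltonian a quadratic polynomial in the total spin, whose components
satisfy the angular momentum relations. It therefore conserves the third component. The transversal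
components precess at a rate proportional to the mean third spin, up to an error of order `1 / |L|`:
their means satisfy `[H, m] = D * meanSpin L 2 + R` with `‖D‖ ≤ |c - a|` and `‖R‖ ≤ |c - a| / |L|`
(`exists_hamiltonian_comm_meanSpin`). In the state polarised along the first axis the mean third
spin tends strongly to zero, so the precession stops in the limit and every space average keeps its
initial value: `M` is the constant `(2, 0, 0)`.

Two ingredients make this rigorous. `norm_evolved_sub_le` integrates the Heisenberg equation on a
fixed vector `ψ`; since `meanSpin L 2` is conserved, it can be moved past the evolution so as to act
directly on `ψ`. `tendsto_gns_meanSpin` gives the strong limits at time zero: on the cyclic vector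
by a law of large numbers, on the dense set of vectors `gnsVector A` by asymptotic centrality of the
means, and on the whole space by the uniform bound on their norms. Of the van Hove condition only
`|L| → ∞` enters. -/

/-! ### Unitary evolution in a C*-algebra -/

theorem norm_le_one_of_mem_unitary {A : Type*} [CStarAlgebra A] {u : A} (hu : u ∈ unitary A) :
    ‖u‖ ≤ 1 := by
  rcases subsingleton_or_nontrivial A with h | h
  · simp [Subsingleton.elim u 0]
  · exact (CStarRing.norm_of_mem_unitary hu).le

theorem norm_exp_I_smul_le {A : Type*} [CStarAlgebra A] {h : A} (hh : IsSelfAdjoint h) (s : ℝ) :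
    ‖NormedSpace.exp (s • (Complex.I • h))‖ ≤ 1 := by
  let _ : NormedAlgebra ℚ A := NormedAlgebra.restrictScalars ℚ ℂ A
  have h1 : s • (Complex.I • h) ∈ skewAdjoint A :=
    (skewAdjoint.smul_mem _ (hh.smul_mem_skewAdjoint Complex.conj_I))
  exact norm_le_one_of_mem_unitary (NormedSpace.exp_mem_unitary_of_mem_skewAdjoint h1)

/-- Heisenberg equation. Each exponential commutes with its generator, so both generators can be
placed next to `B`, where they form the commutator. -/
theorem hasDerivAt_exp_conj {A : Type*} [CStarAlgebra A] (h B : A) (s : ℝ) :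
    HasDerivAt (fun s : ℝ => NormedSpace.exp (s • (Complex.I • h)) * B *
        NormedSpace.exp (s • (-(Complex.I • h))))
      (NormedSpace.exp (s • (Complex.I • h)) * (Complex.I • (h * B - B * h)) *
        NormedSpace.exp (s • (-(Complex.I • h)))) s := by
  have h1 := hasDerivAt_exp_smul_const (𝕂 := ℝ) (Complex.I • h) s
  have h2 := hasDerivAt_exp_smul_const' (𝕂 := ℝ) (-(Complex.I • h)) s
  refine ((h1.mul_const B).mul h2).congr_deriv ?_
  simp only [smul_sub, mul_sub, sub_mul, mul_assoc, smul_mul_assoc, mul_smul_comm, neg_mul, mul_neg]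
  abel

/-- If the commutator of the generator `h` with `B` factors, up to the remainder `R`, through an
element `K` conserved by the dynamics, then `B` moves slowly on vectors that `K` nearly kills. -/
theorem norm_evolved_sub_le {A : Type*} [CStarAlgebra A] {E : Type*} [NormedAddCommGroup E]
    [InnerProductSpace ℂ E] [CompleteSpace E] (π : A →⋆ₐ[ℂ] (E →L[ℂ] E)) {h B D K R : A}
    (hh : IsSelfAdjoint h) (hK : Commute h K) (hB : h * B - B * h = D * K + R) (t : ℝ) (ψ : E) :
    ‖π (NormedSpace.exp ((Complex.I * t) • h) * B * NormedSpace.exp ((-(Complex.I * t)) • h)) ψ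
        - π B ψ‖ ≤ (‖D‖ * ‖π K ψ‖ + ‖R‖ * ‖ψ‖) * |t| := by
  have hπ : ∀ X, ‖π X‖ ≤ ‖X‖ := fun X => NonUnitalStarAlgHom.norm_apply_le π X
  -- Evaluation at `ψ`, taken real-linear because the curve is differentiated in real time.
  let ev : A →L[ℝ] E := LinearMap.mkContinuous
    { toFun := fun X => π X ψ
      map_add' := fun X Y => by simp
      map_smul' := fun r X => by
        rw [← Complex.coe_smul, map_smul]
        simp } ‖ψ‖
    (fun X => by
      rw [mul_comm]
      exact ((π X).le_opNorm ψ).trans (mul_le_mul_of_nonneg_right (hπ X) (norm_nonneg _)))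
  have hev : ∀ X, ev X = π X ψ := fun _ => rfl
  have hn : ∀ s : ℝ, ‖NormedSpace.exp (s • (-(Complex.I • h)))‖ ≤ 1 := fun s => by
    rw [smul_neg, ← neg_smul]
    exact norm_exp_I_smul_le hh (-s)
  -- Conservation of `K` lets it pass the right-hand exponential and reach `ψ`; the bound on the
  -- derivative is then uniform in `s`.
  have hcomm : ∀ s : ℝ, Commute K (NormedSpace.exp (s • (-(Complex.I • h)))) := fun s =>
    ((hK.symm.smul_right _).neg_right.smul_right _).exp_right
  have hd : ∀ s : ℝ, HasDerivAt (fun s : ℝ => ev (NormedSpace.exp (s • (Complex.I • h)) * B *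
        NormedSpace.exp (s • (-(Complex.I • h))))) (ev (NormedSpace.exp (s • (Complex.I • h)) *
        (Complex.I • (h * B - B * h)) * NormedSpace.exp (s • (-(Complex.I • h))))) s := fun s =>
    ev.hasFDerivAt.comp_hasDerivAt s (hasDerivAt_exp_conj h B s)
  have hbd : ∀ s : ℝ, ‖ev (NormedSpace.exp (s • (Complex.I • h)) *
        (Complex.I • (h * B - B * h)) * NormedSpace.exp (s • (-(Complex.I • h))))‖ ≤
        ‖D‖ * ‖π K ψ‖ + ‖R‖ * ‖ψ‖ := by
    intro s
    set u := NormedSpace.exp (s • (Complex.I • h))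
    set v := NormedSpace.exp (s • (-(Complex.I • h)))
    have e : u * (Complex.I • (h * B - B * h)) * v =
        (Complex.I • (u * D * v)) * K + Complex.I • (u * R * v) := by
      rw [hB]
      simp only [smul_add, mul_add, add_mul, mul_smul_comm, smul_mul_assoc]
      rw [mul_assoc u, mul_assoc D, (hcomm s).eq]
      simp only [mul_assoc]
      rfl
    have hc : ∀ X : A, ‖Complex.I • (u * X * v)‖ ≤ ‖X‖ := by
      intro X
      rw [norm_smul, Complex.norm_I, one_mul]
      calc ‖u * X * v‖ ≤ ‖u‖ * ‖X‖ * ‖v‖ :=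
            (norm_mul_le _ _).trans (mul_le_mul_of_nonneg_right (norm_mul_le _ _) (norm_nonneg _))
        _ ≤ 1 * ‖X‖ * 1 := by
            gcongr
            · exact norm_exp_I_smul_le hh s
            · exact hn s
        _ = ‖X‖ := by ring
    rw [hev, e, map_add, map_mul]
    refine (norm_add_le _ _).trans (add_le_add ?_ ?_)
    · exact ((π _).le_opNorm _).trans
        (mul_le_mul_of_nonneg_right ((hπ _).trans (hc D)) (norm_nonneg _))
    · exact ((π _).le_opNorm _).trans
        (mul_le_mul_of_nonneg_right ((hπ _).trans (hc R)) (norm_nonneg _))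
  -- Mean value inequality on all of `ℝ`, so negative times are covered too.
  have := Convex.norm_image_sub_le_of_norm_hasDerivWithin_le (s := Set.univ) (x := 0) (y := t)
    (fun s _ => (hd s).hasDerivWithinAt) (fun s _ => hbd s) convex_univ (Set.mem_univ _)
    (Set.mem_univ _)
  have e1 : t • (Complex.I • h) = (Complex.I * t) • h := by
    rw [← Complex.coe_smul, smul_smul, mul_comm]
  have e2 : t • (-(Complex.I • h)) = (-(Complex.I * t)) • h := by
    rw [smul_neg, e1, neg_smul]
  simpa [e1, e2, hev] using this

/-! ### Angular momentum commutators -/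

/-- The commutation relations of the (doubled) components of an angular momentum. -/
structure SpinRelations {A : Type*} [Ring A] [Algebra ℂ A] (S : Fin 3 → A) : Prop where
  comm01 : S 0 * S 1 - S 1 * S 0 = (2 * Complex.I) • S 2
  comm12 : S 1 * S 2 - S 2 * S 1 = (2 * Complex.I) • S 0
  comm20 : S 2 * S 0 - S 0 * S 2 = (2 * Complex.I) • S 1

namespace SpinRelations

variable {A : Type*} [Ring A] [Algebra ℂ A] {S : Fin 3 → A}

/-- Invariance under rotations about the third axis: the contributions of the first two squares are
opposite. -/
theorem commute_xxz (h : SpinRelations S) (a c : ℂ) :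
    Commute (a • (S 0 * S 0 + S 1 * S 1) + c • (S 2 * S 2)) (S 2) := by
  have h1 : Commute (S 0 * S 0 + S 1 * S 1) (S 2) := by
    have e : (S 0 * S 0 + S 1 * S 1) * S 2 - S 2 * (S 0 * S 0 + S 1 * S 1) =
      -(S 0 * (S 2 * S 0 - S 0 * S 2) + (S 2 * S 0 - S 0 * S 2) * S 0)
      + (S 1 * (S 1 * S 2 - S 2 * S 1) + (S 1 * S 2 - S 2 * S 1) * S 1) := by noncomm_ring
    rw [h.comm20, h.comm12] at e
    refine sub_eq_zero.1 (e.trans ?_)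
    simp only [mul_smul_comm, smul_mul_assoc]
    abel
  exact (h1.smul_left a).add_left (((Commute.refl _).mul_left (Commute.refl _)).smul_left c)

/-- The commutator is a multiple of the anticommutator of `S 1` and `S 2`. Ordering it with the
conserved `S 2` on the right leaves a term linear in the spin, which is one order smaller in the
volume. The factor `c - a` reflects that an isotropic coupling conserves all components. -/
theorem xxz_comm_zero (h : SpinRelations S) (a c : ℂ) :
    (a • (S 0 * S 0 + S 1 * S 1) + c • (S 2 * S 2)) * S 0 -
      S 0 * (a • (S 0 * S 0 + S 1 * S 1) + c • (S 2 * S 2)) =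
      (4 * Complex.I * (c - a)) • (S 1 * S 2) + (4 * (c - a)) • S 0 := by
  have e : (a • (S 0 * S 0 + S 1 * S 1) + c • (S 2 * S 2)) * S 0 -
      S 0 * (a • (S 0 * S 0 + S 1 * S 1) + c • (S 2 * S 2)) =
      (-a) • (S 1 * (S 0 * S 1 - S 1 * S 0) + (S 0 * S 1 - S 1 * S 0) * S 1) +
      c • (S 2 * (S 2 * S 0 - S 0 * S 2) + (S 2 * S 0 - S 0 * S 2) * S 2) := by
    simp only [mul_add, add_mul, mul_sub, sub_mul, smul_add, smul_sub, mul_smul_comm,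
      smul_mul_assoc, mul_assoc, neg_smul]
    abel
  have e' : S 2 * S 1 = S 1 * S 2 - (2 * Complex.I) • S 0 := by rw [← h.comm12]; abel
  rw [e, h.comm01, h.comm20]
  simp only [mul_smul_comm, smul_mul_assoc, e']
  match_scalars <;> ring_nf
  rw [Complex.I_sq]
  ring

theorem xxz_comm_one (h : SpinRelations S) (a c : ℂ) :
    (a • (S 0 * S 0 + S 1 * S 1) + c • (S 2 * S 2)) * S 1 -
      S 1 * (a • (S 0 * S 0 + S 1 * S 1) + c • (S 2 * S 2)) =
      (4 * Complex.I * (a - c)) • (S 0 * S 2) + (4 * (c - a)) • S 1 := by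
  have e : (a • (S 0 * S 0 + S 1 * S 1) + c • (S 2 * S 2)) * S 1 -
      S 1 * (a • (S 0 * S 0 + S 1 * S 1) + c • (S 2 * S 2)) =
      a • (S 0 * (S 0 * S 1 - S 1 * S 0) + (S 0 * S 1 - S 1 * S 0) * S 0) +
      (-c) • (S 2 * (S 1 * S 2 - S 2 * S 1) + (S 1 * S 2 - S 2 * S 1) * S 2) := by
    simp only [mul_add, add_mul, mul_sub, sub_mul, smul_add, smul_sub, mul_smul_comm,
      smul_mul_assoc, mul_assoc, neg_smul]
    abel
  have e' : S 2 * S 0 = S 0 * S 2 + (2 * Complex.I) • S 1 := by rw [← h.comm20]; abel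
  rw [e, h.comm01, h.comm12]
  simp only [mul_smul_comm, smul_mul_assoc, e']
  match_scalars <;> ring_nf
  rw [Complex.I_sq]
  ring

end SpinRelations

/-! ### Pauli matrices in the quasi-local algebra -/

/-- The configurations at a single site. -/
def siteEquiv {G : Type*} (x : G) : (({x} : Finset G) → Fin 2) ≃ Fin 2 where
  toFun u := u ⟨x, Finset.mem_singleton_self x⟩
  invFun k _ := k
  left_inv u := by
    funext y
    exact congrArg u (Subtype.ext (Finset.mem_singleton.1 y.2).symm)
  right_inv _ := rfl

theorem siteTensor_singleton {G : Type*} (x : G) (B : Matrix (Fin 2) (Fin 2) ℂ) :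
    siteTensor {x} B = B.submatrix (siteEquiv x) (siteEquiv x) := by
  ext u v
  rw [siteTensor, Fintype.prod_eq_single ⟨x, Finset.mem_singleton_self x⟩]
  · rfl
  · exact fun y hy => absurd (Subtype.ext (Finset.mem_singleton.1 y.2)) hy

/-- The embedding of the one-site algebra at `x`. -/
noncomputable def siteObs {G : Type*} [DecidableEq G] (x : G) (B : Matrix (Fin 2) (Fin 2) ℂ) :
    QuasiLocal G :=
  localObs {x} (siteTensor {x} B)

theorem siteObs_mul {G : Type*} [DecidableEq G] (x : G) (B C : Matrix (Fin 2) (Fin 2) ℂ) :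
    siteObs x B * siteObs x C = siteObs x (B * C) := by
  rw [siteObs, siteObs, siteObs, ← map_mul]
  congr 1
  simp only [siteTensor_singleton]
  exact Matrix.submatrix_mul_equiv B C _ (siteEquiv x) _

theorem siteObs_smul {G : Type*} [DecidableEq G] (x : G) (z : ℂ) (B : Matrix (Fin 2) (Fin 2) ℂ) :
    siteObs x (z • B) = z • siteObs x B := by
  rw [siteObs, siteObs, ← map_smul]
  congr 1
  simp only [siteTensor_singleton]
  rfl

theorem siteObs_one {G : Type*} [DecidableEq G] (x : G) : siteObs x 1 = 1 := by
  rw [siteObs, ← map_one (localObs ({x} : Finset G))]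
  rw [siteTensor_singleton, Matrix.submatrix_one_equiv]

theorem isSelfAdjoint_pauliAt {G : Type*} [DecidableEq G] (x : G) (i : Fin 3) :
    IsSelfAdjoint (pauliAt x i) := by
  rw [IsSelfAdjoint, pauliAt, ← map_star]
  congr 1
  rw [siteTensor_singleton, Matrix.star_eq_conjTranspose, Matrix.conjTranspose_submatrix]
  congr 1
  ext k l
  fin_cases i <;> fin_cases k <;> fin_cases l <;> simp [pauli]

theorem pauliAt_mul_self {G : Type*} [DecidableEq G] (x : G) (i : Fin 3) :
    pauliAt x i * pauliAt x i = 1 := by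
  change siteObs x _ * siteObs x _ = 1
  rw [siteObs_mul, ← siteObs_one x]
  congr 1
  ext k l
  fin_cases i <;> fin_cases k <;> fin_cases l <;> simp [pauli, Matrix.mul_apply]

theorem pauliAt_mul_pauliAt {G : Type*} [DecidableEq G] (x : G) :
    pauliAt x 0 * pauliAt x 1 = Complex.I • pauliAt x 2 ∧
    pauliAt x 1 * pauliAt x 0 = (-Complex.I) • pauliAt x 2 ∧
    pauliAt x 1 * pauliAt x 2 = Complex.I • pauliAt x 0 ∧
    pauliAt x 2 * pauliAt x 1 = (-Complex.I) • pauliAt x 0 ∧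
    pauliAt x 2 * pauliAt x 0 = Complex.I • pauliAt x 1 ∧
    pauliAt x 0 * pauliAt x 2 = (-Complex.I) • pauliAt x 1 := by
  have h : ∀ i, pauliAt x i = siteObs x (pauli i) := fun _ => rfl
  simp only [h, siteObs_mul, ← siteObs_smul]
  refine ⟨?_, ?_, ?_, ?_, ?_, ?_⟩ <;> congr 1 <;> ext k l <;> fin_cases k <;> fin_cases l <;>
    simp [pauli, Matrix.mul_apply]

/-- Overwriting in one region neither alters the restriction to the other nor depends on the order
of the two overwrites. -/
theorem commute_localObs {G : Type*} [DecidableEq G] {L L' : Finset G} (hd : Disjoint L L')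
    (M : LocalMatrix L) (N : LocalMatrix L') : Commute (localObs L M) (localObs L' N) := by
  have h1 : ∀ (s : G → Fin 2) (u : L → Fin 2), restrict L' (overwrite s u) = restrict L' s := by
    intro s u
    funext x
    have : (x : G) ∉ L := fun h => Finset.disjoint_left.1 hd h x.2
    simp [restrict, overwrite, this]
  have h2 : ∀ (s : G → Fin 2) (u : L' → Fin 2), restrict L (overwrite s u) = restrict L s := by
    intro s u
    funext x
    have : (x : G) ∉ L' := fun h => Finset.disjoint_left.1 hd x.2 h
    simp [restrict, overwrite, this]
  have h3 : ∀ (s : G → Fin 2) (u : L → Fin 2) (v : L' → Fin 2),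
      overwrite (overwrite s u) v = overwrite (overwrite s v) u := by
    intro s u v
    funext x
    by_cases hx : x ∈ L
    · have : x ∉ L' := fun h => Finset.disjoint_left.1 hd hx h
      simp [overwrite, hx, this]
    · simp [overwrite, hx]
  have key : localHom (G := G) L M * localHom L' N = localHom L' N * localHom L M := by
    ext f s
    change localHom L M (localHom L' N f) s = localHom L' N (localHom L M f) s
    simp only [localHom_apply, h1, h2, Finset.mul_sum]
    rw [Finset.sum_comm]
    refine Finset.sum_congr rfl fun v _ => Finset.sum_congr rfl fun u _ => ?_
    rw [h3]
    ring
  exact Subtype.ext key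

theorem commute_pauliAt {G : Type*} [DecidableEq G] {x y : G} (h : x ≠ y) (i j : Fin 3) :
    Commute (pauliAt x i) (pauliAt y j) :=
  commute_localObs (by simpa using h) _ _

theorem norm_pauliAt_le {G : Type*} [DecidableEq G] (x : G) (i : Fin 3) : ‖pauliAt x i‖ ≤ 1 := by
  refine norm_le_one_of_mem_unitary ?_
  rw [Unitary.mem_iff, (isSelfAdjoint_pauliAt x i).star_eq]
  exact ⟨pauliAt_mul_self x i, pauliAt_mul_self x i⟩

/-- Density principle: the inclusion into the bounded operators is isometric, so the image of `S` is
closed, and it contains every local algebra. -/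
theorem quasiLocal_induction {G : Type*} [DecidableEq G] (S : StarSubalgebra ℂ (QuasiLocal G))
    (hS : IsClosed (S : Set (QuasiLocal G))) (h : ∀ L M, localObs L M ∈ S) (A : QuasiLocal G) :
    A ∈ S := by
  have hiso : Isometry (QuasiLocal.toOp G) := fun _ _ => rfl
  have hcl : IsClosed ((S.map (QuasiLocal.toOp G) : StarSubalgebra ℂ _) :
      Set (ConfigSpace G →L[ℂ] ConfigSpace G)) := by
    rw [StarSubalgebra.coe_map]
    have : IsClosedEmbedding (QuasiLocal.toOp G) := hiso.isClosedEmbedding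
    exact this.isClosedMap _ hS
  have hle : quasiLocalSubalgebra G ≤ S.map (QuasiLocal.toOp G) := by
    refine StarSubalgebra.topologicalClosure_minimal ?_ hcl
    refine iSup_le fun L => ?_
    rintro _ ⟨M, rfl⟩
    exact ⟨localObs L M, h L M, rfl⟩
  obtain ⟨B, hB, hBA⟩ := hle A.2
  have : B = A := Subtype.ext hBA
  exact this ▸ hB

/-! ### Total spin, mean spin and the mean-field Hamiltonian -/

/-- The total spin `∑_{x ∈ L} σ_x^i`. -/
noncomputable def totalSpin {G : Type*} [DecidableEq G] (L : Finset G) (i : Fin 3) :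
    QuasiLocal G :=
  ∑ x ∈ L, pauliAt x i

/-- The mean spin `|L|⁻¹ ∑_{x ∈ L} σ_x^i`. -/
noncomputable def meanSpin {G : Type*} [DecidableEq G] (L : Finset G) (i : Fin 3) :
    QuasiLocal G :=
  (1 / (L.card : ℂ)) • totalSpin L i

/-- Distinct sites commute, so only the diagonal of the double sum survives. -/
theorem totalSpin_mul_sub {G : Type*} [DecidableEq G] (L : Finset G) (i j : Fin 3) :
    totalSpin L i * totalSpin L j - totalSpin L j * totalSpin L i =
      ∑ x ∈ L, (pauliAt x i * pauliAt x j - pauliAt x j * pauliAt x i) := by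
  simp only [totalSpin, Finset.sum_mul_sum]
  rw [Finset.sum_comm (f := fun x y => pauliAt x j * pauliAt y i), ← Finset.sum_sub_distrib]
  refine Finset.sum_congr rfl fun x hx => ?_
  rw [← Finset.sum_sub_distrib, Finset.sum_eq_single x]
  · intro y _ hy
    exact sub_eq_zero.2 (commute_pauliAt hy.symm i j)
  · exact fun h => absurd hx h

theorem spinRelations_totalSpin {G : Type*} [DecidableEq G] (L : Finset G) :
    SpinRelations (totalSpin L) := by
  constructor
  all_goals
    rw [totalSpin_mul_sub, totalSpin, Finset.smul_sum]
    refine Finset.sum_congr rfl fun x _ => ?_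
    obtain ⟨h1, h2, h3, h4, h5, h6⟩ := pauliAt_mul_pauliAt x
    simp only [h1, h2, h3, h4, h5, h6]
    match_scalars
    ring

theorem isSelfAdjoint_totalSpin {G : Type*} [DecidableEq G] (L : Finset G) (i : Fin 3) :
    IsSelfAdjoint (totalSpin L i) :=
  isSelfAdjoint_sum _ fun x _ => isSelfAdjoint_pauliAt x i

theorem isSelfAdjoint_meanSpin {G : Type*} [DecidableEq G] (L : Finset G) (i : Fin 3) :
    IsSelfAdjoint (meanSpin L i) := by
  refine IsSelfAdjoint.smul ?_ (isSelfAdjoint_totalSpin L i)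
  simp [IsSelfAdjoint]

theorem norm_meanSpin_le {G : Type*} [DecidableEq G] (L : Finset G) (i : Fin 3) :
    ‖meanSpin L i‖ ≤ 1 := by
  have h : ‖totalSpin L i‖ ≤ L.card := by
    refine (norm_sum_le _ _).trans ?_
    simpa using Finset.sum_le_sum fun x (_ : x ∈ L) => norm_pauliAt_le x i
  rw [meanSpin, norm_smul, norm_div, norm_one, Complex.norm_natCast, one_div]
  exact inv_mul_le_one_of_le₀ h (Nat.cast_nonneg _)

theorem hamiltonian_eq {G : Type*} [DecidableEq G] (a c : ℝ) (L : Finset G) :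
    hamiltonian a c L = (1 / (4 * (L.card : ℂ))) •
      ((a : ℂ) • (totalSpin L 0 * totalSpin L 0 + totalSpin L 1 * totalSpin L 1) +
        (c : ℂ) • (totalSpin L 2 * totalSpin L 2)) := by
  simp only [hamiltonian, totalSpin, Finset.sum_mul_sum, Finset.smul_sum, Finset.sum_add_distrib,
    smul_add]

theorem isSelfAdjoint_hamiltonian {G : Type*} [DecidableEq G] (a c : ℝ) (L : Finset G) :
    IsSelfAdjoint (hamiltonian a c L) := by
  have h : ∀ i, IsSelfAdjoint (totalSpin L i * totalSpin L i) := fun i => by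
    rw [IsSelfAdjoint, star_mul, (isSelfAdjoint_totalSpin L i).star_eq]
  have hr : ∀ r : ℝ, IsSelfAdjoint (r : ℂ) := Complex.conj_ofReal
  rw [hamiltonian_eq]
  refine IsSelfAdjoint.smul (by simp [IsSelfAdjoint])
    ((IsSelfAdjoint.smul (hr a) ((h 0).add (h 1))).add (IsSelfAdjoint.smul (hr c) (h 2)))

theorem commute_hamiltonian_meanSpin {G : Type*} [DecidableEq G] (a c : ℝ) (L : Finset G) :
    Commute (hamiltonian a c L) (meanSpin L 2) := by
  rw [hamiltonian_eq]
  exact (((spinRelations_totalSpin L).commute_xxz a c).smul_left _).smul_right _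

/-- The prefactor is of order `|L|⁻²`. It turns the quadratic part of the commutator into a product
of two means, whereas the linear part becomes a mean divided by `|L|`. -/
theorem exists_hamiltonian_comm_meanSpin {G : Type*} [DecidableEq G] (a c : ℝ) {L : Finset G}
    (hL : L.card ≠ 0) (i : Fin 3) : ∃ D R : QuasiLocal G,
      hamiltonian a c L * meanSpin L i - meanSpin L i * hamiltonian a c L =
        D * meanSpin L 2 + R ∧ ‖D‖ ≤ |c - a| ∧ ‖R‖ ≤ |c - a| / L.card := by
  have hn : (L.card : ℂ) ≠ 0 := Nat.cast_ne_zero.2 hL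
  have hac : ‖(c : ℂ) - a‖ = |c - a| := by
    rw [← Complex.ofReal_sub, Complex.norm_real, Real.norm_eq_abs]
  have hR : ∀ j, ‖(((c : ℂ) - a) / L.card) • meanSpin L j‖ ≤ |c - a| / L.card := fun j => by
    rw [norm_smul, norm_div, hac, Complex.norm_natCast]
    exact mul_le_of_le_one_right (by positivity) (norm_meanSpin_le L j)
  have hD : ∀ j, ‖(Complex.I * ((c : ℂ) - a)) • meanSpin L j‖ ≤ |c - a| := fun j => by
    rw [norm_smul, norm_mul, Complex.norm_I, one_mul, hac]
    exact mul_le_of_le_one_right (by positivity) (norm_meanSpin_le L j)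
  have hS : ∀ j, hamiltonian a c L * meanSpin L j - meanSpin L j * hamiltonian a c L =
      (1 / (4 * (L.card : ℂ)) * (1 / (L.card : ℂ))) •
      (((a : ℂ) • (totalSpin L 0 * totalSpin L 0 + totalSpin L 1 * totalSpin L 1) +
        (c : ℂ) • (totalSpin L 2 * totalSpin L 2)) * totalSpin L j - totalSpin L j *
        ((a : ℂ) • (totalSpin L 0 * totalSpin L 0 + totalSpin L 1 * totalSpin L 1) +
        (c : ℂ) • (totalSpin L 2 * totalSpin L 2))) := fun j => by
    rw [hamiltonian_eq, meanSpin, smul_mul_smul_comm, smul_mul_smul_comm, smul_sub,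
      mul_comm (1 / (L.card : ℂ))]
  fin_cases i
  · refine ⟨(Complex.I * ((c : ℂ) - a)) • meanSpin L 1, (((c : ℂ) - a) / L.card) • meanSpin L 0,
      ?_, hD 1, hR 0⟩
    refine (hS 0).trans ?_
    rw [(spinRelations_totalSpin L).xxz_comm_zero]
    simp only [meanSpin, smul_mul_assoc, mul_smul_comm]
    match_scalars <;> field_simp
  · refine ⟨-((Complex.I * ((c : ℂ) - a)) • meanSpin L 0), (((c : ℂ) - a) / L.card) • meanSpin L 1,
      ?_, (norm_neg _).trans_le (hD 0), hR 1⟩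
    refine (hS 1).trans ?_
    rw [(spinRelations_totalSpin L).xxz_comm_one]
    simp only [meanSpin, smul_mul_assoc, mul_smul_comm, neg_mul]
    match_scalars <;> field_simp
    ring
  · refine ⟨0, 0, ?_, by simp, by rw [norm_zero]; positivity⟩
    rw [zero_mul, zero_add]
    exact sub_eq_zero.2 (commute_hamiltonian_meanSpin a c L)

theorem spaceAverage_eq {G : Type*} [DecidableEq G] (a c : ℝ) (L : Finset G) (t : ℝ) (i : Fin 3) :
    spaceAverage a c L t i = (productState G).gnsStarAlgHom
      (NormedSpace.exp ((Complex.I * t) • hamiltonian a c L) * meanSpin L i *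
        NormedSpace.exp ((-(Complex.I * t)) • hamiltonian a c L)) := by
  rw [spaceAverage, ← map_sum, ← map_smul]
  congr 1
  simp only [evolvedPauli, meanSpin, totalSpin, mul_smul_comm, smul_mul_assoc, Finset.mul_sum,
    Finset.sum_mul]

/-! ### Asymptotic centrality of the mean spin -/

/-- The mean spin is asymptotically central. -/
theorem tendsto_commutator_meanSpin {G : Type*} [DecidableEq G] {l : Filter (Finset G)}
    (hl : Tendsto Finset.card l atTop) (i : Fin 3) (A : QuasiLocal G) :
    Tendsto (fun L => meanSpin L i * A - A * meanSpin L i) l (𝓝 0) := by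
  -- Asymptotically commuting observables form a `*`-subalgebra: products by the Leibniz rule,
  -- adjoints by self-adjointness of the mean. Its closedness follows from the bound `hbd`, uniform
  -- in `L`.
  let S : StarSubalgebra ℂ (QuasiLocal G) :=
    { carrier := {A | Tendsto (fun L => meanSpin L i * A - A * meanSpin L i) l (𝓝 0)}
      mul_mem' := by
        intro A B hA hB
        have := (Tendsto.mul_const B hA).add (Tendsto.const_mul A hB)
        rw [zero_mul, mul_zero, add_zero] at this
        exact this.congr fun L => by noncomm_ring
      add_mem' := by
        intro A B hA hB
        have := Tendsto.add hA hB
        rw [add_zero] at this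
        exact this.congr fun L => by noncomm_ring
      algebraMap_mem' := fun z => by
        refine tendsto_const_nhds.congr fun L => ?_
        rw [Algebra.commutes, sub_self]
      star_mem' := by
        intro A hA
        have := (Tendsto.star hA).neg
        rw [star_zero, neg_zero] at this
        refine this.congr fun L => ?_
        rw [star_sub, star_mul, star_mul, (isSelfAdjoint_meanSpin L i).star_eq, neg_sub] }
  have hbd : ∀ (L : Finset G) (A : QuasiLocal G),
      ‖meanSpin L i * A - A * meanSpin L i‖ ≤ 2 * ‖A‖ := fun L A => by
    refine (norm_sub_le _ _).trans ?_
    rw [two_mul]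
    refine add_le_add ((norm_mul_le _ _).trans ?_) ((norm_mul_le _ _).trans ?_)
    · exact mul_le_of_le_one_left (norm_nonneg _) (norm_meanSpin_le L i)
    · exact mul_le_of_le_one_right (norm_nonneg _) (norm_meanSpin_le L i)
  refine quasiLocal_induction S ?_ ?_ A
  · refine isClosed_of_closure_subset fun A hA => ?_
    change Tendsto _ _ _
    rw [Metric.tendsto_nhds]
    intro ε hε
    obtain ⟨B, hB, hAB⟩ := Metric.mem_closure_iff.1 hA (ε / 4) (by positivity)
    filter_upwards [Metric.tendsto_nhds.1 hB (ε / 2) (by positivity)] with L hL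
    rw [dist_zero_right] at hL ⊢
    rw [dist_eq_norm] at hAB
    have e : meanSpin L i * A - A * meanSpin L i =
        (meanSpin L i * B - B * meanSpin L i) +
          (meanSpin L i * (A - B) - (A - B) * meanSpin L i) := by noncomm_ring
    rw [e]
    have := hbd L (A - B)
    linarith [norm_add_le (meanSpin L i * B - B * meanSpin L i)
      (meanSpin L i * (A - B) - (A - B) * meanSpin L i)]
  · intro L₀ M
    change Tendsto _ _ _
    set B : QuasiLocal G := localObs L₀ M
    have hlim : Tendsto (fun L : Finset G => (L₀.card * (2 * ‖B‖)) / (L.card : ℝ)) l (𝓝 0) :=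
      (tendsto_natCast_atTop_atTop.comp hl).const_div_atTop _
    refine squeeze_zero_norm (fun L => ?_) hlim
    have e : meanSpin L i * B - B * meanSpin L i =
        (1 / (L.card : ℂ)) • ∑ x ∈ L, (pauliAt x i * B - B * pauliAt x i) := by
      rw [meanSpin, totalSpin, smul_mul_assoc, mul_smul_comm, ← smul_sub, Finset.sum_mul,
        Finset.mul_sum, Finset.sum_sub_distrib]
    -- Only sites inside the support `L₀` of `B` contribute, so the sum stays bounded as `L` grows.
    have hs : ‖∑ x ∈ L, (pauliAt x i * B - B * pauliAt x i)‖ ≤ L₀.card * (2 * ‖B‖) := by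
      calc ‖∑ x ∈ L, (pauliAt x i * B - B * pauliAt x i)‖
          = ‖∑ x ∈ L with x ∈ L₀, (pauliAt x i * B - B * pauliAt x i)‖ := by
            rw [Finset.sum_filter_of_ne]
            intro x _ hx
            by_contra h
            exact hx (sub_eq_zero.2 (commute_localObs (by simpa using h) _ _))
        _ ≤ ∑ x ∈ L with x ∈ L₀, 2 * ‖B‖ := by
            refine norm_sum_le_of_le _ fun x _ => (norm_sub_le _ _).trans ?_
            rw [two_mul]
            refine add_le_add ((norm_mul_le _ _).trans ?_) ((norm_mul_le _ _).trans ?_)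
            · exact mul_le_of_le_one_left (norm_nonneg _) (norm_pauliAt_le x i)
            · exact mul_le_of_le_one_right (norm_nonneg _) (norm_pauliAt_le x i)
        _ ≤ L₀.card * (2 * ‖B‖) := by
            rw [Finset.sum_const, nsmul_eq_mul]
            have : (L.filter (· ∈ L₀)).card ≤ L₀.card :=
              Finset.card_le_card fun x hx => (Finset.mem_filter.1 hx).2
            gcongr
    rw [e, norm_smul, norm_div, norm_one, Complex.norm_natCast, one_div, inv_mul_eq_div]
    gcongr

/-! ### GNS vectors and correlations of the product state -/

theorem productState_siteObs {G : Type*} [DecidableEq G] (x : G) (B : Matrix (Fin 2) (Fin 2) ℂ) :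
    productState G (siteObs x B) = Matrix.trace (plusProj * B) := by
  rw [siteObs, productState_localObs, siteTensor_singleton, siteTensor_singleton,
    Matrix.submatrix_mul_equiv]
  exact Fintype.sum_equiv (siteEquiv x) _ _ fun _ => rfl

/-- The vector of the GNS space given by an observable. -/
noncomputable def gnsVector {G : Type*} [DecidableEq G] (A : QuasiLocal G) :
    (productState G).GNS :=
  ((productState G).toPreGNS A : (productState G).PreGNS)

theorem gns_gnsVector {G : Type*} [DecidableEq G] (A B : QuasiLocal G) :
    (productState G).gnsStarAlgHom A (gnsVector B) = gnsVector (A * B) :=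
  (productState G).gnsNonUnitalStarAlgHom_apply_coe

theorem norm_gnsVector_sq {G : Type*} [DecidableEq G] (A : QuasiLocal G) :
    ((‖gnsVector A‖ ^ 2 : ℝ) : ℂ) = productState G (star A * A) := by
  rw [gnsVector, UniformSpace.Completion.norm_coe, Complex.ofReal_pow]
  exact (productState G).preGNS_norm_sq _

/-- The squared norm of the difference is `2 (1 - ω₀(σ¹))`, which vanishes because each spin has
expectation one along the first axis. -/
theorem gnsVector_pauliAt_zero {G : Type*} [DecidableEq G] (x : G) :
    gnsVector (pauliAt x 0) = gnsVector (1 : QuasiLocal G) := by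
  have h := norm_gnsVector_sq (pauliAt x 0 - 1)
  have e : star (pauliAt x 0 - 1) * (pauliAt x 0 - 1) =
      (2 : ℂ) • (siteObs x 1 - siteObs x (pauli 0)) := by
    rw [star_sub, star_one, (isSelfAdjoint_pauliAt x 0).star_eq, sub_mul, mul_sub,
      pauliAt_mul_self, siteObs_one, two_smul]
    change _ - _ - (1 * pauliAt x 0 - _) = 1 - pauliAt x 0 + (1 - pauliAt x 0)
    noncomm_ring
  rw [e, map_smul, map_sub, productState_siteObs, productState_siteObs] at h
  have ht : Matrix.trace (plusProj * 1) - Matrix.trace (plusProj * pauli 0) = 0 := by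
    simp [Matrix.trace, plusProj, pauli, Fin.sum_univ_two]
  rw [ht, smul_zero, Complex.ofReal_eq_zero, sq_eq_zero_iff, norm_eq_zero] at h
  have h' : gnsVector (pauliAt x 0 - 1) = gnsVector (pauliAt x 0) - gnsVector 1 := by
    rw [gnsVector, map_sub]
    exact UniformSpace.Completion.coe_sub _ _
  exact sub_eq_zero.1 (h'.symm.trans h)

/-- The transversal spins at different sites are uncorrelated in the product state. -/
theorem inner_gnsVector_pauliAt {G : Type*} [DecidableEq G] {x y : G} (h : x ≠ y) {i : Fin 3}
    (hi : i ≠ 0) : ⟪gnsVector (pauliAt x i), gnsVector (pauliAt y i)⟫_ℂ = 0 := by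
  -- Symmetry argument: the self-adjoint `U` fixes the vector at `y` and, by anticommutation at the
  -- site `x`, changes the sign of the vector at `x`. The inner product thus equals its own
  -- negative.
  set U := (productState G).gnsStarAlgHom (pauliAt x 0)
  have hfix : ∀ A : QuasiLocal G, gnsVector (A * pauliAt x 0) = gnsVector A := fun A => by
    rw [← gns_gnsVector, gnsVector_pauliAt_zero, gns_gnsVector, mul_one]
  have hy : U (gnsVector (pauliAt y i)) = gnsVector (pauliAt y i) := by
    rw [gns_gnsVector, (commute_pauliAt h 0 i).eq, hfix]
  have hx : U (gnsVector (pauliAt x i)) = -gnsVector (pauliAt x i) := by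
    have e : pauliAt x 0 * pauliAt x i = (-1 : ℂ) • (pauliAt x i * pauliAt x 0) := by
      obtain ⟨h1, h2, h3, h4, h5, h6⟩ := pauliAt_mul_pauliAt x
      fin_cases i
      · exact absurd rfl hi
      · simp [h1, h2]
      · simp [h5, h6]
    rw [gns_gnsVector, e, ← hfix (pauliAt x i)]
    rw [gnsVector, map_smul, neg_one_smul]
    exact UniformSpace.Completion.coe_neg _
  have hadj : ⟪U (gnsVector (pauliAt x i)), gnsVector (pauliAt y i)⟫_ℂ =
      ⟪gnsVector (pauliAt x i), U (gnsVector (pauliAt y i))⟫_ℂ := by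
    have hU : star U = U := by
      rw [← map_star, (isSelfAdjoint_pauliAt x 0).star_eq]
    rw [← ContinuousLinearMap.adjoint_inner_right, ← ContinuousLinearMap.star_eq_adjoint, hU]
  rw [hx, hy, inner_neg_left] at hadj
  exact self_eq_neg.1 hadj.symm

theorem norm_gns_meanSpin_le {G : Type*} [DecidableEq G] (L : Finset G) (i : Fin 3) :
    ‖(productState G).gnsStarAlgHom (meanSpin L i)‖ ≤ 1 :=
  (NonUnitalStarAlgHom.norm_apply_le (productState G).gnsStarAlgHom _).trans
    (norm_meanSpin_le L i)

theorem gns_meanSpin_gnsVector_one {G : Type*} [DecidableEq G] (L : Finset G) (i : Fin 3) :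
    (productState G).gnsStarAlgHom (meanSpin L i) (gnsVector 1) =
      (1 / (L.card : ℂ)) • ∑ x ∈ L, gnsVector (pauliAt x i) := by
  simp only [meanSpin, totalSpin, map_smul, map_sum, smul_apply,
    sum_apply, gns_gnsVector, mul_one]

/-- Weak law of large numbers: `|L|` pairwise orthogonal vectors of equal norm are summed and
divided by `|L|`. -/
theorem norm_gns_meanSpin_gnsVector_one_sq_le {G : Type*} [DecidableEq G] (L : Finset G)
    {i : Fin 3} (hi : i ≠ 0) :
    ‖(productState G).gnsStarAlgHom (meanSpin L i) (gnsVector 1)‖ ^ 2 ≤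
      ‖gnsVector (1 : QuasiLocal G)‖ ^ 2 / L.card := by
  have hv : ∀ x : G, ‖gnsVector (pauliAt x i)‖ = ‖gnsVector (1 : QuasiLocal G)‖ := fun x => by
    have h1 := norm_gnsVector_sq (pauliAt x i)
    rw [(isSelfAdjoint_pauliAt x i).star_eq, pauliAt_mul_self] at h1
    have h2 := norm_gnsVector_sq (1 : QuasiLocal G)
    rw [star_one, one_mul, ← h1, Complex.ofReal_inj] at h2
    exact ((sq_eq_sq₀ (norm_nonneg _) (norm_nonneg _)).1 h2).symm
  have hs : ‖∑ x ∈ L, gnsVector (pauliAt x i)‖ ^ 2 = L.card * ‖gnsVector (1 : QuasiLocal G)‖ ^ 2 := by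
    apply Complex.ofReal_injective
    rw [Complex.ofReal_pow, ← Complex.coe_algebraMap, ← inner_self_eq_norm_sq_to_K (𝕜 := ℂ),
      sum_inner]
    rw [Finset.sum_congr rfl fun x hx => by
      rw [inner_sum, Finset.sum_eq_single_of_mem x hx fun y _ hy =>
        inner_gnsVector_pauliAt hy.symm hi, inner_self_eq_norm_sq_to_K, hv]]
    simp
  rw [gns_meanSpin_gnsVector_one, norm_smul, mul_pow, hs, norm_div, norm_one, Complex.norm_natCast]
  -- For empty `L` both sides vanish, division by zero giving zero.
  rcases Nat.eq_zero_or_pos L.card with h | h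
  · simp [h]
  · have : (0 : ℝ) < L.card := Nat.cast_pos.2 h
    apply le_of_eq
    field_simp

/-! ### Strong limits of the mean spin and of the space averages -/

/-- The magnetisation of the product state in which all spins have `σ¹ = +1`. -/
def plusMagnetization : Fin 3 → ℝ := ![1, 0, 0]

theorem tendsto_gns_meanSpin {G : Type*} [DecidableEq G] {l : Filter (Finset G)}
    (hl : Tendsto Finset.card l atTop) (i : Fin 3) (ψ : (productState G).GNS) :
    Tendsto (fun L => (productState G).gnsStarAlgHom (meanSpin L i) ψ) l
      (𝓝 ((plusMagnetization i : ℂ) • ψ)) := by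
  set π := (productState G).gnsStarAlgHom
  have hcard : Tendsto (fun L : Finset G => (L.card : ℝ)) l atTop :=
    tendsto_natCast_atTop_atTop.comp hl
  have hone : Tendsto (fun L => π (meanSpin L i) (gnsVector 1)) l
      (𝓝 ((plusMagnetization i : ℂ) • gnsVector 1)) := by
    by_cases hi : i = 0
    · subst hi
      refine tendsto_const_nhds.congr' ?_
      filter_upwards [hl.eventually_gt_atTop 0] with L hL
      have hL' : (L.card : ℂ) ≠ 0 := Nat.cast_ne_zero.2 hL.ne'
      rw [gns_meanSpin_gnsVector_one, Finset.sum_congr rfl fun x _ => gnsVector_pauliAt_zero x,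
        Finset.sum_const, ← Nat.cast_smul_eq_nsmul ℂ, smul_smul, one_div, inv_mul_cancel₀ hL']
      simp [plusMagnetization]
    · have h0 : plusMagnetization i = 0 := by
        fin_cases i
        · exact absurd rfl hi
        · rfl
        · rfl
      rw [h0, Complex.ofReal_zero, zero_smul, tendsto_zero_iff_norm_tendsto_zero]
      have hsq : Tendsto (fun L => ‖π (meanSpin L i) (gnsVector 1)‖ ^ 2) l (𝓝 0) :=
        squeeze_zero (fun L => by positivity)
          (fun L => norm_gns_meanSpin_gnsVector_one_sq_le L hi) (hcard.const_div_atTop _)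
      simpa [Real.sqrt_sq] using hsq.sqrt
  have hdense : ∀ A : QuasiLocal G, Tendsto (fun L => π (meanSpin L i) (gnsVector A)) l
      (𝓝 ((plusMagnetization i : ℂ) • gnsVector A)) := by
    intro A
    have h1 := ((π A).continuous.tendsto _).comp hone
    -- Moving the mean past `A` costs a commutator that tends to zero in norm, so the limit on
    -- `gnsVector 1` carries over to `gnsVector A`.
    have h2 : Tendsto (fun L => π (meanSpin L i * A - A * meanSpin L i) (gnsVector 1)) l (𝓝 0) := by
      have hc := (tendsto_commutator_meanSpin hl i A).norm.mul_const
        ‖gnsVector (1 : QuasiLocal G)‖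
      rw [norm_zero, zero_mul] at hc
      exact squeeze_zero_norm (fun L => ((π _).le_opNorm _).trans (mul_le_mul_of_nonneg_right
        (NonUnitalStarAlgHom.norm_apply_le π _) (norm_nonneg _))) hc
    have h3 := h1.add h2
    rw [map_smul, add_zero, gns_gnsVector, mul_one] at h3
    refine h3.congr fun L => ?_
    simp only [Function.comp, map_sub, map_mul, sub_apply, π, mul_apply_eq_comp]
    rw [gns_gnsVector A 1, mul_one]
    abel
  -- All means are contractions, so the set of vectors where convergence holds is closed.
  have heq : Equicontinuous fun (L : Finset G) ψ => π (meanSpin L i) ψ :=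
    (LipschitzWith.uniformEquicontinuous _ 1 fun L =>
      (π (meanSpin L i)).lipschitz.weaken (norm_gns_meanSpin_le L i)).equicontinuous
  induction ψ using UniformSpace.Completion.induction_on with
  | hp => exact heq.isClosed_setOfPred_tendsto (continuous_const_smul _)
  | ih A => exact hdense A

/-- For boxes of side one the cells are single points, and the inner cells count the sites of `L`.
-/
theorem card_tendsto_vanHove (ν : ℕ) : Tendsto Finset.card (vanHove ν) atTop := by
  have h : vanHove ν ≤ comap (innerCells fun _ => 1) atTop :=
    (iInf₂_le (fun _ => 1) fun _ => one_pos).trans inf_le_left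
  refine (tendsto_comap.mono_left h).congr fun L => ?_
  have hc : {k : Fin ν → ℤ | cell (fun _ => 1) k ⊆ L} = L := by
    ext k
    have : cell (fun _ : Fin ν => 1) k = {k} := by
      ext x
      simp only [cell, Set.mem_ofPred_eq, Set.mem_singleton_iff, funext_iff]
      exact forall_congr' fun i => by push_cast; omega
    simp [this]
  rw [innerCells, hc, Set.ncard_coe_finset]

theorem tendsto_spaceAverage {G : Type*} [DecidableEq G] {l : Filter (Finset G)}
    (hl : Tendsto Finset.card l atTop) (a c : ℝ) (i : Fin 3) (t : ℝ) (ψ : (productState G).GNS) :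
    Tendsto (fun L => spaceAverage a c L t i ψ) l (𝓝 ((plusMagnetization i : ℂ) • ψ)) := by
  set π := (productState G).gnsStarAlgHom
  have hcard : Tendsto (fun L : Finset G => (L.card : ℝ)) l atTop :=
    tendsto_natCast_atTop_atTop.comp hl
  -- The third magnetisation is zero, so the conserved factor in the bound on the displacement tends
  -- to zero on `ψ`.
  have h2 := (tendsto_gns_meanSpin hl 2 ψ).norm
  have hb : Tendsto (fun L => (|c - a| * ‖π (meanSpin L 2) ψ‖ + |c - a| / L.card * ‖ψ‖) * |t|) l
      (𝓝 0) := by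
    have := ((h2.const_mul |c - a|).add
      ((hcard.const_div_atTop |c - a|).mul_const ‖ψ‖)).mul_const |t|
    have h0 : plusMagnetization 2 = 0 := rfl
    rwa [h0, Complex.ofReal_zero, zero_smul, norm_zero, mul_zero, zero_mul, add_zero,
      zero_mul] at this
  have hdiff : Tendsto (fun L => spaceAverage a c L t i ψ - π (meanSpin L i) ψ) l (𝓝 0) := by
    refine squeeze_zero_norm' ?_ hb
    filter_upwards [hl.eventually_gt_atTop 0] with L hL
    obtain ⟨D, R, hDR, hD, hR⟩ := exists_hamiltonian_comm_meanSpin a c hL.ne' i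
    rw [spaceAverage_eq]
    refine (norm_evolved_sub_le π (isSelfAdjoint_hamiltonian a c L)
      (commute_hamiltonian_meanSpin a c L) hDR t ψ).trans ?_
    gcongr
  have := hdiff.add (tendsto_gns_meanSpin hl i ψ)
  rw [zero_add] at this
  exact this.congr fun L => sub_add_cancel _ _

end QuantumSpin

theorem proposition3p3p4 (ν : ℕ) (hν : 1 ≤ ν) (a c : ℝ) :
    ∃ M : Fin 3 → ℝ → ℝ,
      (∀ (i : Fin 3) (t : ℝ) (ψ : (QuantumSpin.productState (Fin ν → ℤ)).GNS),
        Tendsto (fun L : Finset (Fin ν → ℤ) => QuantumSpin.spaceAverage a c L t i ψ)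
          (QuantumSpin.vanHove ν) (𝓝 (((1 / 2 * M i t : ℝ) : ℂ) • ψ))) ∧
      ∀ t : ℝ, 0 ≤ t → M 0 t = 2 := by
  -- Constant in time; the 2 cancels the normalisation `1 / 2`.
  refine ⟨fun i _ => 2 * QuantumSpin.plusMagnetization i, fun i t ψ => ?_, fun t _ => ?_⟩
  · have := QuantumSpin.tendsto_spaceAverage (QuantumSpin.card_tendsto_vanHove ν) a c i t ψ
    simpa using this
  · simp [QuantumSpin.plusMagnetization]
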